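/- Let $\mathbb{F}_q$ be a finite field, let $C_2\subseteq C_1\subseteq\mathbb{F}_q^n$ be linear codes of codimension $\ell=\dim C_1-\dim C_2$, let $\vec b_1,\dots,\vec b_{k_2}$ be a basis of $C_2$ and $\vec b_1,\dots,\vec b_{k_2+\ell}$ a basis of $C_1$. The linear ramp secret sharing scheme defined from $C_2\subseteq C_1$ encodes a secret $\vec x\in\mathbb{F}_q^\ell$ as $\vec c=\sum_{j\le k_2}a_j\vec b_j+\sum_{j\le\ell}x_j\vec b_{k_2+j}$ with $\vec a\in\mathbb{F}_q^{k_2}$ uniformly random, and gives $c_i$ to participant $i$. For a set $A$ of participants, the secrets in accordance with the shares of $A$ form an affine space $\vec p+V_A$ with $V_A\subseteq\mathbb{F}_q^\ell$ a subspace depending only on $A$; one says that $A$ holds $\ell-\dim V_A$ $q$-bits of information. The set $A$ is non-$u$-qualifying if it holds fewer than $u$ $q$-bits of information, and maximum non-$u$-qualifying if moreover it has the largest size among all non-$u$-qualifying sets. For $m=1,\dots,\ell$, let $t_m$ be the largest number ($\le n$) such that no set of $t_m$ participants holds $m$ or more $q$-bits of information, and $r_m$ the smallest number such that every set of $r_m$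 participants holds at least $m$ $q$-bits of information. Let $S_1,S_2\subseteq\mathbb{F}_q$ with $\#S_1=\#S_2=s$, let $S=S_1\times S_2$ and $\Delta(s,s)=\{X_1^aX_2^b\mid 0\le a,b<s\}$, and for $L\subseteq\Delta(s,s)$ let $C(L)\subseteq\mathbb{F}_q^{S}$ be the span of the vectors $(M(\alpha))_{\alpha\in S}$, $M\in L$; the participants are thus the $n=s^2$ points of $S$. Let $\prec$ be the graded lexicographic ordering with $X_1\prec X_2$, that is, $X_1^{a}X_2^{b}\prec X_1^{c}X_2^{d}$ if $a+b<c+d$, or if $a+b=c+d$ and $b<d$. Let $0\le i_1<i_2\le s-1$ and $$L_1=\{N\in\Delta(s,s)\mid N\preceq X_1^{i_1}X_2^{i_2}\},\qquad L_2=\{N\in\Delta(s,s)\mid N\prec X_1^{i_2}X_2^{i_1}\}.$$ Then $C(L_2)\subseteq C(L_1)$ has codimension $\ell=i_2-i_1+1$, and every secret sharing scheme defined from $C(L_2)\subseteq C(L_1)$ satisfies, for $m=1,\dots,\ell$, $$t_m\ge (i_1+m)(i_2+1)-\frac{m(m-1)}{2}-1,$$ $$r_m=s^2-\Big[(s-i_1)(s-i_2)+\sum_{t=2}^{\ell-m+1}\big((s-i_1)-(t-1)\big)\Big]+1=s^2-(s-i_1)(s-i_2+\ell-m)+\frac{(\ell-m+1)(\ell-m)}{2}+1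 .$$ Moreover, write $S_\nu=\{\beta^{(\nu)}_1,\dots,\beta^{(\nu)}_s\}$ for $\nu=1,2$, in any order, and for $w=1,\dots,\ell$ put $$T_w=\{\beta^{(1)}_{(i_2+2)-w},\dots,\beta^{(1)}_s\}\times\{\beta^{(2)}_{i_1+w},\dots,\beta^{(2)}_s\}.$$ Then for every $\mathcal{J}\subseteq\{1,\dots,\ell\}$ the set $S\setminus\bigcup_{i\in\mathcal{J}}T_i$ is non-$u$-qualifying, where $u=\ell+1-\#\mathcal{J}$. If $\mathcal{J}=\{1,\dots,\#\mathcal{J}\}$ or $\mathcal{J}=\{u,\dots,\ell\}$, then this set is maximum non-$u$-qualifying. -/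

import Mathlib

/-- A linear ramp secret sharing scheme given by the coset construction: `base` is a basis of the
small code, and `base` together with `ext` is a basis of the big code. The share of participant `i`
is the `i`-th coordinate of a codeword; secrets are vectors of length `ℓ` over `F`. -/
structure LinearRampScheme (F P : Type*) [Field F] (k₂ ℓ : ℕ) where
  base : Fin k₂ → P → F
  ext : Fin ℓ → P → F
  linearIndependent : LinearIndependent F (Sum.elim base ext)

namespace LinearRampScheme

variable {F P : Type*} [Field F] {k₂ ℓ : ℕ} (R : LinearRampScheme F P k₂ ℓ)

/-- The big code `C₁`. -/
def code₁ : Submodule F (P → F) := Submodule.span F (Set.range (Sum.elim R.base R.ext))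

/-- The small code `C₂`. -/
def code₂ : Submodule F (P → F) := Submodule.span F (Set.range R.base)

/-- The vector of shares of the secret `x`, computed with the random coefficients `a`. -/
def encode (a : Fin k₂ → F) (x : Fin ℓ → F) : P → F :=
  ∑ j, a j • R.base j + ∑ j, x j • R.ext j

/-- The secrets that are in accordance with the shares `c` at the positions in `A`. -/
def possibleSecrets (A : Finset P) (c : P → F) : Set (Fin ℓ → F) :=
  {x | ∃ a, ∀ i ∈ A, R.encode a x i = c i}

/-- The direction `V` of the solution space `p + V` of all secrets in accordance with the shares
held by `A`; see `possibleSecrets_eq`. -/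
def ambiguity (A : Finset P) : Submodule F (Fin ℓ → F) where
  carrier := R.possibleSecrets A 0
  zero_mem' := ⟨0, fun i _ => by simp [encode]⟩
  add_mem' := by
    rintro x y ⟨a, ha⟩ ⟨b, hb⟩
    refine ⟨a + b, fun i hi => ?_⟩
    have h1 := ha i hi
    have h2 := hb i hi
    simp only [encode, Pi.add_apply, add_smul, Finset.sum_add_distrib, Pi.zero_apply] at *
    linear_combination h1 + h2
  smul_mem' := by
    rintro c x ⟨a, ha⟩
    refine ⟨c • a, fun i hi => ?_⟩
    have h1 := ha i hi
    simp only [encode, Pi.add_apply, Pi.smul_apply, smul_assoc, ← Finset.smul_sum,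
      Pi.zero_apply] at *
    rw [← smul_add, h1, smul_zero]

/-- For every actual secret `x` and all shares of it, the set of secrets in accordance with the
shares held by `A` is the affine space `x + V`. -/
theorem possibleSecrets_eq (A : Finset P) (a : Fin k₂ → F) (x : Fin ℓ → F) :
    R.possibleSecrets A (R.encode a x) = {y | y - x ∈ R.ambiguity A} := by
  ext y
  constructor
  · rintro ⟨b, hb⟩
    refine ⟨b - a, fun i hi => ?_⟩
    have h1 := hb i hi
    simp only [encode, Pi.add_apply, Pi.sub_apply, sub_smul, Finset.sum_sub_distrib,
      Pi.zero_apply] at *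
    linear_combination h1
  · rintro ⟨b, hb⟩
    refine ⟨b + a, fun i hi => ?_⟩
    have h1 := hb i hi
    simp only [encode, Pi.add_apply, Pi.sub_apply, sub_smul, add_smul, Finset.sum_sub_distrib,
      Finset.sum_add_distrib, Pi.zero_apply] at *
    linear_combination h1

/-- The number of `q`-bits of information on the secret held by the set `A` of participants,
`ℓ - dim V` (the subtraction never truncates, as `V ⊆ F ^ ℓ`). -/
noncomputable def information (A : Finset P) : ℕ := ℓ - Module.finrank F (R.ambiguity A)

/-- The set `A` cannot recover `i` `q`-bits of information. -/
def NonQualifying (i : ℕ) (A : Finset P) : Prop := R.information A < i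

/-- `A` is of largest possible size among the non-`i`-qualifying sets. -/
def MaximumNonQualifying (i : ℕ) (A : Finset P) : Prop :=
  R.NonQualifying i A ∧ ∀ B : Finset P, R.NonQualifying i B → B.card ≤ A.card

/-- `t` is the privacy number `t_m`: the largest size such that no set of `t` participants can
recover `m` `q`-bits of information. -/
def IsPrivacyNumber [Fintype P] (m t : ℕ) : Prop :=
  IsGreatest {t | t ≤ Fintype.card P ∧
    ∀ A : Finset P, A.card = t → ¬ m ≤ R.information A} t

/-- `r` is the reconstruction number `r_m`: the smallest size such that any set of `r` participants
can recover `m` `q`-bits of information. -/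
def IsReconstructionNumber [Fintype P] (m r : ℕ) : Prop :=
  IsLeast {r | r ≤ Fintype.card P ∧
    ∀ A : Finset P, A.card = r → m ≤ R.information A} r

end LinearRampScheme

namespace MonomialCartesian

/-- The exponent of the monomial `X₁ ^ a * X₂ ^ b`; the variables `X₁`, `X₂` are `X 0`, `X 1`. -/
noncomputable def expo (a b : ℕ) : Fin 2 →₀ ℕ := Finsupp.single 0 a + Finsupp.single 1 b

/-- The (strict) graded lexicographic ordering on monomials in two variables with `X₁ ≺ X₂`. -/
def GrLexLT (d e : Fin 2 →₀ ℕ) : Prop :=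
  d 0 + d 1 < e 0 + e 1 ∨ (d 0 + d 1 = e 0 + e 1 ∧ d 1 < e 1)

/-- The reflexive closure of `GrLexLT`. -/
def GrLexLE (d e : Fin 2 →₀ ℕ) : Prop := GrLexLT d e ∨ d = e

/-- `Δ(s, s)`. -/
def Delta (s : ℕ) : Set (Fin 2 →₀ ℕ) := {d | ∀ v, d v < s}

variable {F : Type*} [Field F]

/-- Evaluation of bivariate polynomials at all the points of `S₁ × S₂`. -/
noncomputable def ev (S₁ S₂ : Finset F) : MvPolynomial (Fin 2) F →ₗ[F] (S₁ × S₂ → F) :=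
  LinearMap.pi fun p => (MvPolynomial.aeval ![(p.1 : F), (p.2 : F)]).toLinearMap

/-- The monomial-Cartesian code `C(L)`. -/
noncomputable def code (S₁ S₂ : Finset F) (L : Set (Fin 2 →₀ ℕ)) : Submodule F (S₁ × S₂ → F) :=
  (Submodule.span F ((fun d => MvPolynomial.monomial d (1 : F)) '' L)).map (ev S₁ S₂)

/-- The box
`T_w = {β₁_((i₂+2)-w), …, β₁_s} × {β₂_(i₁+w), …, β₂_s}`. The element with (one-based) index `j` in
the enumeration `β` is `β ⟨j - 1, _⟩`. -/
def box {s : ℕ} {S₁ S₂ : Finset F} (β₁ : Fin s ≃ S₁) (β₂ : Fin s ≃ S₂) (i₁ i₂ w : ℕ) :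
    Finset (S₁ × S₂) :=
  Finset.univ.filter fun p =>
    (i₂ + 2) - w ≤ (β₁.symm p.1 : ℕ) + 1 ∧ i₁ + w ≤ (β₂.symm p.2 : ℕ) + 1

end MonomialCartesian

/-!
Order the monomials by `≺` and call a monomial standard for a set `A` of points if its evaluation
on `A` is not a linear combination of the evaluations of smaller monomials. Puncturing the codes to
the shares of `A` shows that `A` holds as many `q`-bits as there are standard monomials for `A` in
`L₁ \ L₂`, that is, on the antidiagonal segment from `X₁ ^ i₁ * X₂ ^ i₂` to `X₁ ^ i₂ * X₂ ^ i₁`.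

The standard monomials for `A` form a lower set of exactly `#A` exponents in the square `[0, s)²`.
A lower set meeting the segment in `m` points contains the staircase below these points, whose area
is smallest when the points are consecutive at an end of the segment; this bounds `#A` from below
and hence bounds `t_m`. The complement of a lower set in the square, reflected in the centre, is
again a lower set, so the same estimate bounds from above the size of a set missing part of the
segment. That bound is attained: if `A` avoids the box `T_w`, then a product of linear factors in
`X₁` and linear factors in `X₂` vanishes on `A`, so its leading monomial, the `w`-th one of the
segment, is not standard for `A`; and the union of the first or of the last few boxes is a
staircase of extremal area.
-/

section StandardIndices

variable {K V ι κ : Type*} [Field K] [AddCommGroup V] [Module K V] [LinearOrder κ]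

/-- The indices `i` whose vector `φ i` is not a linear combination of the vectors whose index has a
smaller key than `i`. Indices are compared through the key function `k`, so that `ι` may carry an
unrelated order. -/
def standardIndices (K : Type*) {V ι κ : Type*} [Field K] [AddCommGroup V] [Module K V]
    [LinearOrder κ] (k : ι → κ) (φ : ι → V) : Set ι :=
  {i | φ i ∉ Submodule.span K (φ '' {j | k j < k i})}

theorem linearIndepOn_standardIndices {k : ι → κ} (hk : k.Injective) (φ : ι → V) :
    LinearIndepOn K φ (standardIndices K k φ) := by
  classical
  refine linearIndepOn_of_finite _ fun T hT hfin => ?_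
  lift T to Finset ι using hfin
  induction T using Finset.induction_on_max_value k with
  | empty => simp
  | insert a T ha hmax ih =>
    rw [Finset.coe_insert, Set.insert_subset_iff] at hT
    rw [Finset.coe_insert]
    refine (ih hT.2).insert fun hmem => hT.1 (Submodule.span_mono (Set.image_mono ?_) hmem)
    exact fun x hx => (hmax x hx).lt_of_ne fun h => ha (hk h ▸ hx)

theorem finite_standardIndices [Module.Finite K V] {k : ι → κ} (hk : k.Injective) (φ : ι → V) :
    (standardIndices K k φ).Finite :=
  (linearIndepOn_standardIndices hk φ).finite_of_isNoetherian

variable [WellFoundedLT κ] {J J₁ J₂ : Set κ}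

theorem span_image_standardIndices_inter (k : ι → κ) (φ : ι → V) (hJ : IsLowerSet J) :
    Submodule.span K (φ '' (standardIndices K k φ ∩ k ⁻¹' J)) =
      Submodule.span K (φ '' (k ⁻¹' J)) := by
  refine le_antisymm (Submodule.span_mono (Set.image_mono Set.inter_subset_right))
    (Submodule.span_le.mpr ?_)
  rintro _ ⟨i, hi, rfl⟩
  induction i using WellFounded.induction (InvImage.wf k wellFounded_lt) with
  | _ i ih =>
    by_cases hstd : i ∈ standardIndices K k φ
    · exact Submodule.subset_span ⟨i, ⟨hstd, hi⟩, rfl⟩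
    · refine Submodule.span_le.mpr ?_ (not_not.mp hstd)
      rintro _ ⟨j, hj, rfl⟩
      exact ih j hj (hJ (le_of_lt hj) hi)

variable {k : ι → κ}

theorem finrank_span_image_eq_ncard (hk : k.Injective) (φ : ι → V) (hJ : IsLowerSet J) :
    Module.finrank K (Submodule.span K (φ '' (k ⁻¹' J))) =
      (standardIndices K k φ ∩ k ⁻¹' J).ncard := by
  have hli : LinearIndepOn K φ (standardIndices K k φ ∩ k ⁻¹' J) :=
    (linearIndepOn_standardIndices hk φ).mono Set.inter_subset_left
  rw [← span_image_standardIndices_inter k φ hJ, ← hli.injOn.ncard_image, Module.finrank,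
    rank_span_set hli.id_image]
  rfl

theorem finrank_span_image_eq_add [Module.Finite K V] (hk : k.Injective) (φ : ι → V)
    (h₁ : IsLowerSet J₁) (h₂ : IsLowerSet J₂) (h : J₂ ⊆ J₁) :
    Module.finrank K (Submodule.span K (φ '' (k ⁻¹' J₁))) =
      Module.finrank K (Submodule.span K (φ '' (k ⁻¹' J₂))) +
        (standardIndices K k φ ∩ k ⁻¹' (J₁ \ J₂)).ncard := by
  have hfin := finite_standardIndices (K := K) hk φ
  rw [finrank_span_image_eq_ncard hk φ h₁, finrank_span_image_eq_ncard hk φ h₂,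
    ← Set.ncard_union_eq _ (hfin.inter_of_left _) (hfin.inter_of_left _),
    ← Set.inter_union_distrib_left, ← Set.preimage_union, Set.union_sdiff_cancel h]
  exact (Set.disjoint_sdiff_right.preimage k).mono Set.inter_subset_right Set.inter_subset_right

end StandardIndices

section StandardMonomials

open MvPolynomial
open scoped MonomialOrder

variable {σ K B : Type*} [Field K] [CommRing B] [Algebra K B] {m : MonomialOrder σ}
  {f : MvPolynomial σ K →ₐ[K] B}

/-- The exponents of the standard monomials (the footprint) of the ideal `ker f`: those monomials
whose image under `f` is not a linear combination of the images of smaller monomials. -/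
def standardMonomials (m : MonomialOrder σ) (f : MvPolynomial σ K →ₐ[K] B) : Set (σ →₀ ℕ) :=
  standardIndices K m.toSyn fun d => f (monomial d 1)

theorem isLowerSet_standardMonomials : IsLowerSet (standardMonomials m f) := by
  intro e d hde he hd
  refine he (?_ : f (monomial e 1) ∈ _)
  have hmul (c : σ →₀ ℕ) :
      f (monomial (c + (e - d)) 1) = f (monomial (e - d) 1) * f (monomial c 1) := by
    rw [← map_mul, monomial_mul, one_mul, add_comm]
  have hmem := Submodule.mem_map_of_mem (f := LinearMap.mulLeft K (f (monomial (e - d) 1))) hd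
  rw [Submodule.map_span, ← Set.image_comp, LinearMap.mulLeft_apply, ← hmul,
    add_tsub_cancel_of_le hde] at hmem
  refine Submodule.span_mono ?_ hmem
  rintro _ ⟨c, hc, rfl⟩
  refine ⟨c + (e - d), ?_, hmul c⟩
  calc m.toSyn (c + (e - d)) < m.toSyn (d + (e - d)) := by
        rw [map_add, map_add]; exact add_lt_add_left hc _
    _ = m.toSyn e := by rw [add_tsub_cancel_of_le hde]

theorem degree_notMem_standardMonomials {p : MvPolynomial σ K} (hp : p ≠ 0) (hfp : f p = 0) :
    m.degree p ∉ standardMonomials m f := by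
  classical
  refine not_not.mpr (?_ : f (monomial (m.degree p) 1) ∈ _)
  have hsum : p.coeff (m.degree p) • f (monomial (m.degree p) 1) +
      ∑ e ∈ p.support.erase (m.degree p), p.coeff e • f (monomial e 1) = 0 := by
    rw [Finset.add_sum_erase _ (fun e => p.coeff e • f (monomial e 1)) (m.degree_mem_support hp),
      ← hfp]
    conv_rhs => rw [p.as_sum, map_sum]
    simp only [← map_smul, smul_eq_mul, mul_one]
  rw [← Submodule.smul_mem_iff _ (m.coeff_degree_ne_zero_iff.mpr hp),
    eq_neg_of_add_eq_zero_left hsum]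
  refine neg_mem (sum_mem fun e he => Submodule.smul_mem _ _ (Submodule.subset_span ⟨e, ?_, rfl⟩))
  obtain ⟨hne, he⟩ := Finset.mem_erase.mp he
  exact (m.le_degree he).lt_of_ne (m.toSyn.injective.ne hne)

theorem ncard_standardMonomials (hf : Function.Surjective f) :
    (standardMonomials m f).ncard = Module.finrank K B := by
  have h := finrank_span_image_eq_ncard (K := K) m.toSyn.injective (fun d => f (monomial d 1))
    isLowerSet_univ
  have htop : Submodule.span K (Set.range fun d => f (monomial d 1)) = ⊤ := by
    have hbasis := congrArg (Submodule.map f.toLinearMap) (basisMonomials σ K).span_eq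
    rw [Submodule.map_span, ← Set.range_comp, Submodule.map_top] at hbasis
    simpa [Function.comp_def, LinearMap.range_eq_top (f := f.toLinearMap).mpr hf] using hbasis
  rwa [Set.preimage_univ, Set.inter_univ, Set.image_univ, htop, finrank_top, eq_comm] at h

theorem degree_prod_X_sub_C {ι : Type*} (i : σ) (T : Finset ι) (c : ι → K) :
    m.degree (∏ j ∈ T, (X i - C (c j))) = Finsupp.single i T.card := by
  rw [m.degree_prod fun j _ => (m.monic_X_sub_C i (c j)).ne_zero]
  simp [m.degree_X_sub_C]

end StandardMonomials

section EvalPoints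

open MvPolynomial

variable {σ K P : Type*} [Field K] {x : P → σ → K}

/-- The evaluation of polynomials at the points of the family `x`. -/
noncomputable def evalPoints (x : P → σ → K) : MvPolynomial σ K →ₐ[K] (P → K) :=
  AlgHom.pi fun p => aeval (x p)

theorem exists_aeval_eq_one_and_aeval_eq_zero (hx : x.Injective) {p : P} {T : Finset P}
    (hp : p ∉ T) : ∃ g : MvPolynomial σ K, aeval (x p) g = 1 ∧ ∀ q ∈ T, aeval (x q) g = 0 := by
  induction T using Finset.cons_induction with
  | empty => exact ⟨1, by simp⟩
  | cons q T hq ih =>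
    obtain ⟨hpq, hpT⟩ := not_or.mp (mt Finset.mem_cons.mpr hp)
    obtain ⟨g, hg_one, hg_zero⟩ := ih hpT
    obtain ⟨i, hi⟩ := Function.ne_iff.mp (hx.ne hpq)
    refine ⟨C (x p i - x q i)⁻¹ * (X i - C (x q i)) * g, ?_, fun r hr => ?_⟩
    · simp [-aeval_eq_eval, hg_one, sub_ne_zero.mpr hi]
    · rcases Finset.mem_cons.mp hr with rfl | hr
      · simp
      · simp [-aeval_eq_eval, hg_zero r hr]

theorem surjective_evalPoints [Finite P] (hx : x.Injective) :
    Function.Surjective (evalPoints x) := by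
  classical
  have := Fintype.ofFinite P
  intro y
  choose g hg_one hg_zero using fun p =>
    exists_aeval_eq_one_and_aeval_eq_zero hx (Finset.notMem_erase p .univ)
  refine ⟨∑ p, y p • g p, funext fun q => ?_⟩
  simp only [evalPoints, AlgHom.pi_apply, map_sum, map_smul]
  rw [Finset.sum_eq_single q (fun p _ hpq => ?_) (by simp), hg_one, smul_eq_mul, mul_one]
  rw [hg_zero p q (by simp [hpq.symm]), smul_zero]

end EvalPoints

section GrLex

open Finsupp MonomialCartesian
open scoped MonomialOrder

/-- The monomial order whose strict part is `GrLexLT`. In Mathlib's `MonomialOrder.degLex` the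
variable `X 0` is the largest one, hence the exchange of the two variables. -/
noncomputable def grLex : MonomialOrder (Fin 2) where
  syn := DegLex (Fin 2 →₀ ℕ)
  toSyn := (Finsupp.domCongr (Equiv.swap 0 1)).trans MonomialOrder.degLex.toSyn
  toSyn_monotone _ _ h := MonomialOrder.degLex.toSyn_monotone fun i => h (Equiv.swap 0 1 i)

theorem grLex_lt_iff {d e : Fin 2 →₀ ℕ} : d ≺[grLex] e ↔ GrLexLT d e := by
  have hlex (a b : Fin 2 →₀ ℕ) :
      toLex a < toLex b ↔ a 0 < b 0 ∨ a 0 = b 0 ∧ a 1 < b 1 := by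
    simp [Lex.lt_iff, Fin.exists_fin_two, Fin.forall_fin_two]
  change toDegLex (equivMapDomain (Equiv.swap 0 1) d) <
    toDegLex (equivMapDomain (Equiv.swap 0 1) e) ↔ _
  simp only [DegLex.lt_iff, ofDegLex_toDegLex, hlex, degree_eq_sum, Fin.sum_univ_two, GrLexLT,
    equivMapDomain_apply, Equiv.symm_swap, Equiv.swap_apply_left, Equiv.swap_apply_right]
  omega

theorem grLex_le_iff {d e : Fin 2 →₀ ℕ} : d ≼[grLex] e ↔ GrLexLE d e := by
  rw [le_iff_lt_or_eq, grLex_lt_iff, grLex.toSyn.injective.eq_iff, GrLexLE]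

end GrLex

section Quotient

variable {K V : Type*} [Field K] [AddCommGroup V] [Module K V] {U W : Submodule K V}

theorem finrank_map_mkQ_add_finrank [FiniteDimensional K W] (h : U ≤ W) :
    Module.finrank K (W.map U.mkQ) + Module.finrank K U = Module.finrank K W := by
  rw [← LinearMap.finrank_range_add_finrank_ker (U.mkQ.domRestrict W), LinearMap.range_domRestrict,
    LinearMap.ker_domRestrict, Submodule.ker_mkQ,
    ← (Submodule.submoduleOfEquivOfLe h).finrank_eq, Submodule.submoduleOf]

end Quotient

namespace LinearRampScheme

variable {F P : Type*} [Field F] {k₂ ℓ : ℕ} {R : LinearRampScheme F P k₂ ℓ} {A B : Finset P}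

theorem information_mono (h : A ⊆ B) : R.information A ≤ R.information B :=
  have hle : R.ambiguity B ≤ R.ambiguity A := by
    rintro x ⟨a, ha⟩
    exact ⟨a, fun i hi => ha i (h hi)⟩
  Nat.sub_le_sub_left (Submodule.finrank_mono hle) ℓ

theorem information_empty : R.information ∅ = 0 := by
  have htop : R.ambiguity ∅ = ⊤ := eq_top_iff.mpr fun _ _ => ⟨0, by simp⟩
  rw [information, htop, finrank_top, Module.finrank_fin_fun, Nat.sub_self]

theorem finrank_code₁ : Module.finrank F R.code₁ = k₂ + ℓ := by
  rw [code₁, finrank_span_eq_card R.linearIndependent, Fintype.card_sum, Fintype.card_fin,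
    Fintype.card_fin]

theorem finrank_code₂ : Module.finrank F R.code₂ = k₂ := by
  have hbase : LinearIndependent F R.base := R.linearIndependent.comp Sum.inl Sum.inl_injective
  rw [code₂, finrank_span_eq_card hbase, Fintype.card_fin]

/-- The puncturing of a vector of shares outside `A`. -/
def restrict (F : Type*) {P : Type*} [Field F] (A : Finset P) : (P → F) →ₗ[F] (A → F) :=
  LinearMap.funLeft F F Subtype.val

theorem restrict_eq_zero_iff {c : P → F} : restrict F A c = 0 ↔ ∀ i ∈ A, c i = 0 := by
  simp [restrict, funext_iff, LinearMap.funLeft_apply]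

theorem mem_code₂_iff {c : P → F} : c ∈ R.code₂ ↔ ∃ a : Fin k₂ → F, ∑ j, a j • R.base j = c :=
  Submodule.mem_span_range_iff_exists_fun F

theorem code₁_eq_range_sup_code₂ (R : LinearRampScheme F P k₂ ℓ) :
    R.code₁ = LinearMap.range (Fintype.linearCombination F R.ext) ⊔ R.code₂ := by
  rw [code₁, code₂, Set.Sum.elim_range, Submodule.span_union, sup_comm,
    Fintype.range_linearCombination]

theorem code₂_le_code₁ (R : LinearRampScheme F P k₂ ℓ) : R.code₂ ≤ R.code₁ :=
  R.code₁_eq_range_sup_code₂ ▸ le_sup_right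

theorem ambiguity_eq_ker (R : LinearRampScheme F P k₂ ℓ) (A : Finset P) :
    R.ambiguity A = LinearMap.ker ((R.code₂.map (restrict F A)).mkQ ∘ₗ restrict F A ∘ₗ
      Fintype.linearCombination F R.ext) := by
  ext x
  have hmem : x ∈ R.ambiguity A ↔
      ∃ a : Fin k₂ → F, restrict F A (∑ j, a j • R.base j + ∑ j, x j • R.ext j) = 0 :=
    exists_congr fun a => restrict_eq_zero_iff.symm
  rw [hmem, LinearMap.mem_ker, LinearMap.comp_apply, Submodule.mkQ_apply,
    Submodule.Quotient.mk_eq_zero, ← neg_mem_iff, Submodule.mem_map]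
  simp only [mem_code₂_iff, exists_exists_eq_and, map_add, add_eq_zero_iff_eq_neg,
    LinearMap.comp_apply, Fintype.linearCombination_apply]

theorem finrank_restrict_code₁ (R : LinearRampScheme F P k₂ ℓ) (A : Finset P) :
    Module.finrank F (R.code₁.map (restrict F A)) =
      Module.finrank F (R.code₂.map (restrict F A)) + R.information A := by
  set U := R.code₂.map (restrict F A)
  have hrange : LinearMap.range (U.mkQ ∘ₗ restrict F A ∘ₗ Fintype.linearCombination F R.ext) =
      (R.code₁.map (restrict F A)).map U.mkQ := by
    rw [code₁_eq_range_sup_code₂, Submodule.map_sup, Submodule.map_sup, LinearMap.range_comp,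
      LinearMap.range_comp, Submodule.mkQ_map_self, sup_bot_eq]
  have hker := LinearMap.finrank_range_add_finrank_ker
    (U.mkQ ∘ₗ restrict F A ∘ₗ Fintype.linearCombination F R.ext)
  have hquot := finrank_map_mkQ_add_finrank (U := U) (Submodule.map_mono R.code₂_le_code₁)
  rw [hrange, ← ambiguity_eq_ker, Module.finrank_fin_fun] at hker
  rw [information]
  lia

theorem information_univ [Fintype P] (R : LinearRampScheme F P k₂ ℓ) :
    R.information .univ = ℓ := by
  have hinj : Function.Injective (restrict F (Finset.univ : Finset P)) :=
    (injective_iff_map_eq_zero _).mpr fun c hc =>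
      funext fun i => restrict_eq_zero_iff.mp hc i (Finset.mem_univ i)
  have h := R.finrank_restrict_code₁ .univ
  rw [← (Submodule.equivMapOfInjective _ hinj _).finrank_eq,
    ← (Submodule.equivMapOfInjective _ hinj _).finrank_eq, finrank_code₁, finrank_code₂] at h
  exact (Nat.add_left_cancel h).symm

theorem information_eq_ncard {ι κ : Type*} [LinearOrder κ] [WellFoundedLT κ] {k : ι → κ}
    (hk : k.Injective) {φ : ι → P → F} {J₁ J₂ : Set κ} (h₁ : IsLowerSet J₁) (h₂ : IsLowerSet J₂)
    (h : J₂ ⊆ J₁) (hC₁ : R.code₁ = Submodule.span F (φ '' (k ⁻¹' J₁)))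
    (hC₂ : R.code₂ = Submodule.span F (φ '' (k ⁻¹' J₂))) (A : Finset P) :
    R.information A =
      (standardIndices F k (fun i => restrict F A (φ i)) ∩ k ⁻¹' (J₁ \ J₂)).ncard := by
  have hfin := R.finrank_restrict_code₁ A
  rw [hC₁, hC₂, Submodule.map_span, Submodule.map_span, ← Set.image_comp, ← Set.image_comp,
    finrank_span_image_eq_add hk _ h₁ h₂ h] at hfin
  exact (Nat.add_left_cancel hfin).symm

variable [Fintype P] {m n : ℕ}

theorem exists_isPrivacyNumber (hm : 1 ≤ m) : ∃ t, R.IsPrivacyNumber m t := by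
  refine BddAbove.exists_isGreatest_of_nonempty
    ⟨Fintype.card P, fun t ht => ht.1⟩ ⟨0, Nat.zero_le _, fun A hA => ?_⟩
  rw [Finset.card_eq_zero.mp hA, information_empty]
  lia

theorem IsPrivacyNumber.le_add_one {t : ℕ} (ht : R.IsPrivacyNumber m t) (hm : m ≤ ℓ)
    (h : ∀ A : Finset P, m ≤ R.information A → n ≤ A.card) :
    n ≤ t + 1 := by
  have hn : n ≤ Fintype.card P := h .univ (R.information_univ.symm ▸ hm)
  by_contra! hlt
  have hle : n - 1 ≤ t := ht.2 ⟨by lia, fun A hA hinf => by have := h A hinf; lia⟩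
  lia

theorem isReconstructionNumber_card_add_one (hm : m ≤ ℓ)
    (hA : R.MaximumNonQualifying m A) : R.IsReconstructionNumber m (A.card + 1) := by
  obtain ⟨hnon, hmax⟩ := hA
  refine ⟨⟨?_, fun B hB => ?_⟩, fun r hr => ?_⟩
  · refine A.card_lt_iff_ne_univ.mpr ?_
    rintro rfl
    exact hm.not_gt (R.information_univ ▸ hnon)
  · by_contra! hlt
    have := hmax B hlt
    lia
  · by_contra! hlt
    obtain ⟨B, hBA, hB⟩ := Finset.exists_subset_card_eq (Nat.le_of_lt_succ hlt)
    exact ((hr.2 B hB).trans (information_mono hBA)).not_gt hnon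

end LinearRampScheme

section Staircase

/-- The union of the rectangles `[0, a) × [0, W - a)` for `a ∈ T`, a region of lattice points under
a descending staircase whose corners lie on the line `x + y = W`. -/
def staircase (W : ℕ) (T : Finset ℕ) : Finset (ℕ × ℕ) :=
  T.biUnion fun a => Finset.range a ×ˢ Finset.range (W - a)

variable {W M N : ℕ} {T : Finset ℕ}

theorem mem_staircase {p : ℕ × ℕ} : p ∈ staircase W T ↔ ∃ a ∈ T, p.1 < a ∧ p.2 < W - a := by
  simp [staircase]

theorem card_staircase_insert {a b : ℕ} (ha : a ∈ T) (hmax : ∀ c ∈ T, c ≤ a) (hab : a < b) :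
    (staircase W (insert b T)).card = (staircase W T).card + (b - a) * (W - b) := by
  have hunion : staircase W (insert b T) =
      staircase W T ∪ Finset.Ico a b ×ˢ Finset.range (W - b) := by
    ext ⟨x, y⟩
    simp only [Finset.mem_union, mem_staircase, Finset.exists_mem_insert, Finset.mem_product,
      Finset.mem_Ico, Finset.mem_range]
    constructor
    · rintro (h | h)
      · by_cases hx : x < a
        · exact .inl ⟨a, ha, hx, by lia⟩
        · exact .inr ⟨by lia, h.2⟩
      · exact .inl h
    · rintro (h | h)
      · exact .inr h
      · exact .inl ⟨h.1.2, h.2⟩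
  have hdisj : Disjoint (staircase W T) (Finset.Ico a b ×ˢ Finset.range (W - b)) := by
    simp only [Finset.disjoint_left, mem_staircase, Finset.mem_product, Finset.mem_Ico]
    rintro p ⟨c, hc, hpc, -⟩ hp
    have := hmax c hc
    lia
  rw [hunion, Finset.card_union_of_disjoint hdisj, Finset.card_product, Nat.card_Ico,
    Finset.card_range]

theorem add_card_le_of_subset_Icc {a n : ℕ} (hT : T ⊆ Finset.Icc n a) (hne : T.Nonempty) :
    n + T.card ≤ a + 1 := by
  have hcard := Finset.card_le_card hT
  rw [Nat.card_Icc] at hcard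
  have := hne.card_pos
  lia

theorem le_card_staircase_of_max {a : ℕ} (hT : T ⊆ Finset.Icc 1 a) (ha : a ∈ T) {k : ℕ}
    (hk : T.card = k + 1) (haW : a ≤ W) :
    a * (W - a) + k * a ≤ (staircase W T).card + (k + 1).choose 2 := by
  induction T using Finset.induction_on_max generalizing a k with
  | empty => simp at ha
  | insert b T hb ih =>
    have hba : b = a := by
      rcases Finset.mem_insert.mp ha with h | h
      · exact h.symm
      · exact absurd (hb a h) (Finset.mem_Icc.mp (hT (T.mem_insert_self b))).2.not_gt
    subst hba
    rw [Finset.card_insert_of_notMem fun h => (hb b h).false, Nat.add_right_cancel_iff] at hk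
    rcases T.eq_empty_or_nonempty with rfl | hne
    · obtain rfl : k = 0 := by simpa using hk.symm
      simp [staircase]
    obtain ⟨k, rfl⟩ := Nat.exists_eq_succ_of_ne_zero (hk ▸ hne.card_ne_zero)
    have hmax (c : ℕ) (hc : c ∈ T) : c ≤ T.max' hne := T.le_max' c hc
    have hTmax : T ⊆ Finset.Icc 1 (T.max' hne) := fun c hc => Finset.mem_Icc.mpr
      ⟨(Finset.mem_Icc.mp (hT (Finset.mem_insert_of_mem hc))).1, hmax c hc⟩
    have hlt := hb _ (T.max'_mem hne)
    have hkmax := add_card_le_of_subset_Icc hTmax hne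
    have hih := ih hTmax (T.max'_mem hne) hk (hlt.le.trans haW)
    rw [card_staircase_insert (T.max'_mem hne) hmax hlt, Nat.choose_succ_succ' (k + 1) 1,
      Nat.choose_one_right]
    generalize T.max' hne = a at *
    obtain ⟨g, rfl⟩ : ∃ g, b = a + g + 1 := ⟨b - a - 1, by lia⟩
    obtain ⟨v, rfl⟩ := Nat.exists_eq_add_of_le haW
    obtain ⟨e, rfl⟩ : ∃ e, a = k + 1 + e := ⟨a - (k + 1), by lia⟩
    rw [show k + 1 + e + g + 1 + v - (k + 1 + e) = g + 1 + v by lia] at hih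
    rw [Nat.add_sub_cancel_left, show k + 1 + e + g + 1 - (k + 1 + e) = g + 1 by lia]
    have hslack : 0 ≤ g * e := Nat.zero_le _
    linarith

theorem le_card_staircase (hN : 1 ≤ N) (hT : T ⊆ Finset.Icc N M) {k : ℕ} (hk : T.card = k + 1) :
    M * (N + k) ≤ (staircase (M + N) T).card + (k + 1).choose 2 := by
  have hne : T.Nonempty := Finset.card_pos.mp (by lia)
  have hTmax : T ⊆ Finset.Icc N (T.max' hne) := fun c hc => Finset.mem_Icc.mpr
    ⟨(Finset.mem_Icc.mp (hT hc)).1, T.le_max' c hc⟩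
  have hkmax := add_card_le_of_subset_Icc hTmax hne
  have hM := (Finset.mem_Icc.mp (hT (T.max'_mem hne))).2
  refine le_trans ?_ (le_card_staircase_of_max
    (hTmax.trans (Finset.Icc_subset_Icc_left hN)) (T.max'_mem hne) hk (by lia))
  generalize T.max' hne = a at *
  obtain ⟨g, rfl⟩ := Nat.exists_eq_add_of_le hM
  obtain ⟨e, rfl⟩ : ∃ e, a = N + k + e := ⟨a - (N + k), by lia⟩
  rw [show N + k + e + g + N - (N + k + e) = g + N by lia]
  have hslack : 0 ≤ g * e := Nat.zero_le _
  linarith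

theorem card_staircase_Icc {k : ℕ} (h : N + k ≤ M) :
    (staircase (M + N) (Finset.Icc N (N + k))).card + (k + 1).choose 2 = M * (N + k) := by
  induction k with
  | zero => simp [staircase, mul_comm]
  | succ k ih =>
    have hinsert : insert (N + (k + 1)) (Finset.Icc N (N + k)) = Finset.Icc N (N + (k + 1)) :=
      Finset.insert_Icc_right_eq_Icc_succ (by simp; lia)
    rw [← hinsert, card_staircase_insert (Finset.right_mem_Icc.mpr (by lia))
      (fun c hc => (Finset.mem_Icc.mp hc).2) (by lia), Nat.choose_succ_succ' (k + 1) 1,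
      Nat.choose_one_right, show N + (k + 1) - (N + k) = 1 by lia, one_mul]
    have := ih (by lia)
    have : (k + 1) ≤ M := by lia
    lia

theorem card_staircase_image_sub (hT : ∀ a ∈ T, a ≤ W) :
    (staircase W (T.image (W - ·))).card = (staircase W T).card := by
  rw [← Finset.card_map (Equiv.prodComm ℕ ℕ).toEmbedding]
  congr 1
  ext ⟨x, y⟩
  simp only [Finset.mem_map_equiv, mem_staircase, Finset.exists_mem_image]
  refine exists_congr fun a => and_congr_right fun ha => ?_
  simp [Nat.sub_sub_self (hT a ha), and_comm]

theorem card_staircase_Icc_sub {k : ℕ} (h : N + k ≤ M) :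
    (staircase (M + N) (Finset.Icc (M - k) M)).card + (k + 1).choose 2 = M * (N + k) := by
  have himage : (Finset.Icc N (N + k)).image (M + N - ·) = Finset.Icc (M - k) M := by
    ext a
    simp only [Finset.mem_image, Finset.mem_Icc]
    exact ⟨by lia, fun ha => ⟨M + N - a, by lia⟩⟩
  rw [← himage, card_staircase_image_sub fun a ha => by have := Finset.mem_Icc.mp ha; lia,
    card_staircase_Icc h]

end Staircase

section LowerSet

/-- The lattice points `(x, y)` on the line `x + y = i₁ + i₂` with `i₁ ≤ x ≤ i₂`. -/
def antidiagonalSegment (i₁ i₂ : ℕ) : Finset (ℕ × ℕ) :=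
  (Finset.Icc i₁ i₂).image fun x => (x, i₁ + i₂ - x)

variable {i₁ i₂ k s : ℕ} {U : Finset (ℕ × ℕ)}

theorem mem_antidiagonalSegment {p : ℕ × ℕ} :
    p ∈ antidiagonalSegment i₁ i₂ ↔ p.1 + p.2 = i₁ + i₂ ∧ i₁ ≤ p.1 ∧ p.1 ≤ i₂ := by
  obtain ⟨x, y⟩ := p
  simp only [antidiagonalSegment, Finset.mem_image, Finset.mem_Icc, Prod.mk.injEq]
  exact ⟨by lia, fun h => ⟨x, by lia⟩⟩

theorem card_antidiagonalSegment : (antidiagonalSegment i₁ i₂).card = i₂ + 1 - i₁ := by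
  rw [antidiagonalSegment, Finset.card_image_of_injective, Nat.card_Icc]
  exact fun _ _ h => congrArg Prod.fst h

theorem le_card_of_isLowerSet
    (hU : IsLowerSet (U : Set (ℕ × ℕ))) (hk : k < (U ∩ antidiagonalSegment i₁ i₂).card) :
    (i₂ + 1) * (i₁ + 1 + k) ≤ U.card + (k + 1).choose 2 := by
  obtain ⟨V, hV, hVcard⟩ := Finset.exists_subset_card_eq hk
  have hVU (p : ℕ × ℕ) (hp : p ∈ V) : p ∈ U := (Finset.mem_inter.mp (hV hp)).1
  have hVseg (p : ℕ × ℕ) (hp : p ∈ V) : p.1 + p.2 = i₁ + i₂ ∧ i₁ ≤ p.1 ∧ p.1 ≤ i₂ :=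
    mem_antidiagonalSegment.mp (Finset.mem_inter.mp (hV hp)).2
  have hinj : Set.InjOn (fun p : ℕ × ℕ => p.1 + 1) V := fun p hp q hq hpq => by
    have := hVseg p hp
    have := hVseg q hq
    exact Prod.ext (Nat.succ_injective hpq) (by lia)
  have hT : V.image (fun p => p.1 + 1) ⊆ Finset.Icc (i₁ + 1) (i₂ + 1) :=
    Finset.image_subset_iff.mpr fun p hp => by
      have := hVseg p hp
      exact Finset.mem_Icc.mpr (by lia)
  have hstair : staircase (i₂ + 1 + (i₁ + 1)) (V.image fun p => p.1 + 1) ⊆ U := fun q hq => by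
    obtain ⟨_, ha, hq₁, hq₂⟩ := mem_staircase.mp hq
    obtain ⟨p, hp, rfl⟩ := Finset.mem_image.mp ha
    have := hVseg p hp
    exact hU (Prod.mk_le_mk.mpr ⟨by lia, by lia⟩ : q ≤ p) (hVU p hp)
  calc (i₂ + 1) * (i₁ + 1 + k)
      ≤ (staircase (i₂ + 1 + (i₁ + 1)) (V.image fun p => p.1 + 1)).card + (k + 1).choose 2 :=
        le_card_staircase (by lia) hT ((Finset.card_image_of_injOn hinj).trans hVcard)
    _ ≤ U.card + (k + 1).choose 2 := by gcongr

/-- The point reflection of the square `[0, s) × [0, s)`. -/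
def squareReflection (s : ℕ) (p : ℕ × ℕ) : ℕ × ℕ := (s - 1 - p.1, s - 1 - p.2)

theorem squareReflection_injOn :
    Set.InjOn (squareReflection s) (Finset.range s ×ˢ Finset.range s : Finset (ℕ × ℕ)) := by
  rintro ⟨x, y⟩ hp ⟨x', y'⟩ hq h
  simp only [Finset.coe_product, Finset.coe_range, Set.mem_prod, Set.mem_Iio] at hp hq
  simp only [squareReflection, Prod.mk.injEq] at h ⊢
  lia

/-- The complement of `U` in the square `[0, s) × [0, s)`, reflected so that it is again a lower
set when `U` is one. -/
def reflectedComplement (s : ℕ) (U : Finset (ℕ × ℕ)) : Finset (ℕ × ℕ) :=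
  ((Finset.range s ×ˢ Finset.range s) \ U).image (squareReflection s)

theorem mem_reflectedComplement {p : ℕ × ℕ} :
    p ∈ reflectedComplement s U ↔ p.1 < s ∧ p.2 < s ∧ squareReflection s p ∉ U := by
  have hinvol {q : ℕ × ℕ} (h₁ : q.1 < s) (h₂ : q.2 < s) :
      squareReflection s (squareReflection s q) = q :=
    Prod.ext (Nat.sub_sub_self (Nat.le_sub_one_of_lt h₁))
      (Nat.sub_sub_self (Nat.le_sub_one_of_lt h₂))
  simp only [reflectedComplement, Finset.mem_image, Finset.mem_sdiff, Finset.mem_product,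
    Finset.mem_range]
  constructor
  · rintro ⟨q, ⟨⟨h₁, h₂⟩, hq⟩, rfl⟩
    rw [hinvol h₁ h₂]
    simp only [squareReflection]
    exact ⟨by lia, by lia, hq⟩
  · rintro ⟨h₁, h₂, hp⟩
    refine ⟨squareReflection s p, ⟨?_, hp⟩, hinvol h₁ h₂⟩
    simp only [squareReflection]
    lia

theorem isLowerSet_reflectedComplement (hU : IsLowerSet (U : Set (ℕ × ℕ))) :
    IsLowerSet (reflectedComplement s U : Set (ℕ × ℕ)) := by
  intro q p hpq hq
  obtain ⟨h₁, h₂, hq⟩ := mem_reflectedComplement.mp hq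
  refine mem_reflectedComplement.mpr ⟨hpq.1.trans_lt h₁, hpq.2.trans_lt h₂, fun hp => hq ?_⟩
  exact hU ⟨Nat.sub_le_sub_left hpq.1 _, Nat.sub_le_sub_left hpq.2 _⟩ hp

theorem card_reflectedComplement (hU : U ⊆ Finset.range s ×ˢ Finset.range s) :
    (reflectedComplement s U).card + U.card = s ^ 2 := by
  rw [reflectedComplement, Finset.card_image_of_injOn (squareReflection_injOn.mono
    (Finset.coe_subset.mpr Finset.sdiff_subset)), Finset.card_sdiff_add_card_eq_card hU,
    Finset.card_product, Finset.card_range, sq]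

theorem card_sdiff_le_card_reflectedComplement_inter (hi : i₂ < s) :
    (antidiagonalSegment i₁ i₂ \ U).card ≤
      (reflectedComplement s U ∩ antidiagonalSegment (s - 1 - i₂) (s - 1 - i₁)).card := by
  refine Finset.card_le_card_of_injOn (squareReflection s) (fun p hp => ?_)
    (squareReflection_injOn.mono fun p hp => ?_)
  all_goals
    obtain ⟨hp, hpU⟩ := Finset.mem_sdiff.mp hp
    rw [mem_antidiagonalSegment] at hp
  · refine Finset.mem_coe.mpr (Finset.mem_inter.mpr ⟨Finset.mem_image_of_mem _ ?_, ?_⟩)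
    · simp only [Finset.mem_sdiff, Finset.mem_product, Finset.mem_range]
      exact ⟨by lia, hpU⟩
    · simp only [mem_antidiagonalSegment, squareReflection]
      lia
  · simp only [Finset.coe_product, Finset.coe_range, Set.mem_prod, Set.mem_Iio]
    lia

theorem card_add_le_of_isLowerSet
    (hU : IsLowerSet (U : Set (ℕ × ℕ))) (hUs : U ⊆ Finset.range s ×ˢ Finset.range s)
    (h₁ : i₁ ≤ i₂) (h₂ : i₂ < s) (hk : k < (antidiagonalSegment i₁ i₂ \ U).card) :
    U.card + (s - i₁) * (s - i₂ + k) ≤ s ^ 2 + (k + 1).choose 2 := by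
  have hle := le_card_of_isLowerSet (isLowerSet_reflectedComplement (s := s) hU)
    (hk.trans_le (card_sdiff_le_card_reflectedComplement_inter h₂))
  have hcard := card_reflectedComplement hUs
  rw [show s - 1 - i₁ + 1 = s - i₁ by lia, show s - 1 - i₂ + 1 = s - i₂ by lia] at hle
  lia

end LowerSet

namespace MonomialCartesian

section Boxes

variable {F : Type*} [DecidableEq F] {S₁ S₂ : Finset F} {s i₁ i₂ k : ℕ}

theorem card_biUnion_box (β₁ : Fin s ≃ S₁) (β₂ : Fin s ≃ S₂) (hi : i₁ ≤ i₂) (his : i₂ < s)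
    {J : Finset ℕ} (hJ : J ⊆ Finset.Icc 1 (i₂ - i₁ + 1)) :
    (J.biUnion (box β₁ β₂ i₁ i₂)).card =
      (staircase (s - i₁ + (s - i₂)) (J.image fun w => s - i₂ + w - 1)).card := by
  have hbox {p : S₁ × S₂} {w : ℕ} (hw : w ∈ J) : p ∈ box β₁ β₂ i₁ i₂ w ↔
      ((β₁.symm p.1).rev : ℕ) < s - i₂ + w - 1 ∧
        ((β₂.symm p.2).rev : ℕ) < s - i₁ + (s - i₂) - (s - i₂ + w - 1) := by
    have := Finset.mem_Icc.mp (hJ hw)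
    simp only [box, Finset.mem_filter_univ, Fin.val_rev]
    lia
  refine Finset.card_nbij (fun p => (((β₁.symm p.1).rev : ℕ), ((β₂.symm p.2).rev : ℕ)))
    (fun p hp => ?_) (fun p _ q _ hpq => ?_) (fun q hq => ?_)
  · obtain ⟨w, hw, hp⟩ := Finset.mem_biUnion.mp hp
    exact mem_staircase.mpr ⟨_, Finset.mem_image_of_mem _ hw, (hbox hw).mp hp⟩
  · simpa [Prod.ext_iff, -Fin.val_rev, Fin.val_inj] using hpq
  · obtain ⟨_, ha, hq₁, hq₂⟩ := mem_staircase.mp hq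
    obtain ⟨w, hw, rfl⟩ := Finset.mem_image.mp ha
    have := Finset.mem_Icc.mp (hJ hw)
    let p : S₁ × S₂ := (β₁ (Fin.rev ⟨q.1, by lia⟩), β₂ (Fin.rev ⟨q.2, by lia⟩))
    have hp : (((β₁.symm p.1).rev : ℕ), ((β₂.symm p.2).rev : ℕ)) = q := by
      simp [p, -Fin.val_rev]
    rw [← hp] at hq₁ hq₂
    exact ⟨p, Finset.mem_biUnion.mpr ⟨w, hw, (hbox hw).mpr ⟨hq₁, hq₂⟩⟩, hp⟩

theorem card_biUnion_box_Icc_one (β₁ : Fin s ≃ S₁) (β₂ : Fin s ≃ S₂) (his : i₂ < s)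
    (hk : i₁ + k ≤ i₂) :
    ((Finset.Icc 1 (k + 1)).biUnion (box β₁ β₂ i₁ i₂)).card + (k + 1).choose 2 =
      (s - i₁) * (s - i₂ + k) := by
  have himage : (Finset.Icc 1 (k + 1)).image (fun w => s - i₂ + w - 1) =
      Finset.Icc (s - i₂) (s - i₂ + k) := by
    ext a
    simp only [Finset.mem_image, Finset.mem_Icc]
    exact ⟨by lia, fun ha => ⟨a + 1 - (s - i₂), by lia⟩⟩
  rw [card_biUnion_box β₁ β₂ (by lia) his (Finset.Icc_subset_Icc_right (by lia)), himage,
    card_staircase_Icc (by lia)]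

theorem card_biUnion_box_Icc_sub (β₁ : Fin s ≃ S₁) (β₂ : Fin s ≃ S₂) (his : i₂ < s)
    (hk : i₁ + k ≤ i₂) :
    ((Finset.Icc (i₂ - i₁ + 1 - k) (i₂ - i₁ + 1)).biUnion (box β₁ β₂ i₁ i₂)).card +
      (k + 1).choose 2 = (s - i₁) * (s - i₂ + k) := by
  have himage : (Finset.Icc (i₂ - i₁ + 1 - k) (i₂ - i₁ + 1)).image (fun w => s - i₂ + w - 1) =
      Finset.Icc (s - i₁ - k) (s - i₁) := by
    ext a
    simp only [Finset.mem_image, Finset.mem_Icc]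
    exact ⟨by lia, fun ha => ⟨a + 1 - (s - i₂), by lia⟩⟩
  rw [card_biUnion_box β₁ β₂ (by lia) his (Finset.Icc_subset_Icc_left (by lia)), himage,
    card_staircase_Icc_sub (by lia)]

theorem card_compl_biUnion_box_add (β₁ : Fin s ≃ S₁) (β₂ : Fin s ≃ S₂) (his : i₂ < s)
    (hk : i₁ + k ≤ i₂) {J : Finset ℕ}
    (hJ : J = Finset.Icc 1 (k + 1) ∨ J = Finset.Icc (i₂ - i₁ + 1 - k) (i₂ - i₁ + 1)) :
    (Finset.univ \ J.biUnion (box β₁ β₂ i₁ i₂)).card + (s - i₁) * (s - i₂ + k) =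
      s ^ 2 + (k + 1).choose 2 := by
  have hbox : (J.biUnion (box β₁ β₂ i₁ i₂)).card + (k + 1).choose 2 =
      (s - i₁) * (s - i₂ + k) := by
    rcases hJ with rfl | rfl
    exacts [card_biUnion_box_Icc_one β₁ β₂ his hk, card_biUnion_box_Icc_sub β₁ β₂ his hk]
  have hcompl := Finset.card_sdiff_add_card_eq_card
    (Finset.subset_univ (J.biUnion (box β₁ β₂ i₁ i₂)))
  rw [Finset.card_univ, Fintype.card_prod, ← Fintype.card_congr β₁, ← Fintype.card_congr β₂,
    Fintype.card_fin, ← sq] at hcompl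
  lia

end Boxes

section Footprint

open Finsupp MvPolynomial

theorem expo_apply_zero (a b : ℕ) : expo a b 0 = a := by simp [expo]

theorem expo_apply_one (a b : ℕ) : expo a b 1 = b := by simp [expo]

theorem expo_apply_apply (d : Fin 2 →₀ ℕ) : expo (d 0) (d 1) = d := by
  ext i
  fin_cases i
  exacts [expo_apply_zero _ _, expo_apply_one _ _]

/-- The points of `S₁ × S₂` as a family of points of the plane. -/
def gridPoint {F : Type*} {S₁ S₂ : Finset F} (p : S₁ × S₂) : Fin 2 → F := ![p.1, p.2]

theorem gridPoint_injective {F : Type*} {S₁ S₂ : Finset F} :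
    Function.Injective (gridPoint : S₁ × S₂ → Fin 2 → F) := fun _ _ h =>
  Prod.ext (Subtype.ext (congrFun h 0)) (Subtype.ext (congrFun h 1))

variable {F P : Type*} [Field F] [Finite P] {x : P → Fin 2 → F}

/-- The exponents `(a, b)` of the monomials `X₁ ^ a * X₂ ^ b` that are standard, with respect to
`grLex`, for the vanishing ideal of the points of the family `x`. -/
noncomputable def footprint (x : P → Fin 2 → F) : Finset (ℕ × ℕ) :=
  (finite_standardIndices (K := F) grLex.toSyn.injective
    fun d => evalPoints x (monomial d 1)).toFinset.image fun d => (d 0, d 1)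

theorem apply_mem_footprint {d : Fin 2 →₀ ℕ} :
    (d 0, d 1) ∈ footprint x ↔ d ∈ standardMonomials grLex (evalPoints x) := by
  simp only [footprint, Finset.mem_image, Set.Finite.mem_toFinset, Prod.mk.injEq]
  refine ⟨fun ⟨e, he, h₀, h₁⟩ => ?_, fun hd => ⟨d, hd, rfl, rfl⟩⟩
  rwa [← expo_apply_apply d, ← h₀, ← h₁, expo_apply_apply e]

theorem mem_footprint {p : ℕ × ℕ} :
    p ∈ footprint x ↔ expo p.1 p.2 ∈ standardMonomials grLex (evalPoints x) := by
  rw [← apply_mem_footprint, expo_apply_zero, expo_apply_one]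

theorem isLowerSet_footprint : IsLowerSet (footprint x : Set (ℕ × ℕ)) := by
  intro q p hpq hq
  refine mem_footprint.mpr (isLowerSet_standardMonomials ?_ (mem_footprint.mp hq))
  exact add_le_add (single_mono hpq.1) (single_mono hpq.2)

theorem card_footprint (hx : x.Injective) : (footprint x).card = Nat.card P := by
  have := Fintype.ofFinite P
  have hinj : Function.Injective fun d : Fin 2 →₀ ℕ => (d 0, d 1) := fun d e h => by
    rw [← expo_apply_apply d, ← expo_apply_apply e, (Prod.mk.inj h).1, (Prod.mk.inj h).2]
  rw [footprint, Finset.card_image_of_injective _ hinj,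
    ← Set.ncard_eq_toFinset_card (hs := finite_standardIndices grLex.toSyn.injective _)]
  exact (ncard_standardMonomials (surjective_evalPoints hx)).trans
    ((Module.finrank_fintype_fun_eq_card F).trans Fintype.card_eq_nat_card)

theorem card_card_notMem_footprint {T₁ T₂ : Finset F} (h : ∀ p, x p 0 ∈ T₁ ∨ x p 1 ∈ T₂) :
    (T₁.card, T₂.card) ∉ footprint x := by
  have hne (i : Fin 2) (T : Finset F) : ∏ c ∈ T, (X i - C c) ≠ (0 : MvPolynomial (Fin 2) F) :=
    Finset.prod_ne_zero_iff.mpr fun c _ => (grLex.monic_X_sub_C i c).ne_zero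
  have hzero : evalPoints x ((∏ c ∈ T₁, (X 0 - C c)) * ∏ c ∈ T₂, (X 1 - C c)) = 0 := by
    funext p
    simp only [evalPoints, AlgHom.pi_apply, map_mul, map_prod, map_sub, aeval_X, aeval_C,
      Algebra.algebraMap_self_apply, Pi.zero_apply, mul_eq_zero, Finset.prod_eq_zero_iff]
    exact (h p).imp (fun hp => ⟨_, hp, sub_self _⟩) fun hp => ⟨_, hp, sub_self _⟩
  have hdeg := degree_notMem_standardMonomials (m := grLex)
    (mul_ne_zero (hne 0 T₁) (hne 1 T₂)) hzero
  rwa [grLex.degree_mul (hne 0 T₁) (hne 1 T₂), degree_prod_X_sub_C, degree_prod_X_sub_C,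
    ← expo, ← mem_footprint (p := (T₁.card, T₂.card))] at hdeg

theorem footprint_subset_product {T₁ T₂ : Finset F} (h₁ : ∀ p, x p 0 ∈ T₁)
    (h₂ : ∀ p, x p 1 ∈ T₂) :
    footprint x ⊆ Finset.range T₁.card ×ˢ Finset.range T₂.card := by
  rintro ⟨a, b⟩ hp
  rw [Finset.mem_product, Finset.mem_range, Finset.mem_range]
  by_contra! hle
  have hlower {q : ℕ × ℕ} (hq : q ≤ (a, b)) : q ∈ footprint x := isLowerSet_footprint hq hp
  by_cases ha : a < T₁.card
  · exact card_card_notMem_footprint (T₁ := ∅) (T₂ := T₂) (fun p => .inr (h₂ p))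
      (hlower ⟨Nat.zero_le _, hle ha⟩)
  · exact card_card_notMem_footprint (T₁ := T₁) (T₂ := ∅) (fun p => .inl (h₁ p))
      (hlower ⟨not_lt.mp ha, Nat.zero_le _⟩)

variable {S₁ S₂ : Finset F} {s i₁ i₂ : ℕ}

theorem footprint_comp_gridPoint_subset (hS₁ : S₁.card = s) (hS₂ : S₂.card = s) (g : P → S₁ × S₂) :
    footprint (gridPoint ∘ g) ⊆ Finset.range s ×ˢ Finset.range s := by
  have h := footprint_subset_product (x := gridPoint ∘ g) (T₁ := S₁) (T₂ := S₂)
    (fun p => (g p).1.2) (fun p => (g p).2.2)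
  rwa [hS₁, hS₂] at h

theorem footprint_gridPoint (hS₁ : S₁.card = s) (hS₂ : S₂.card = s) :
    footprint (gridPoint : S₁ × S₂ → Fin 2 → F) = Finset.range s ×ˢ Finset.range s := by
  refine Finset.eq_of_subset_of_card_le (footprint_comp_gridPoint_subset hS₁ hS₂ id) ?_
  rw [card_footprint gridPoint_injective, Nat.card_prod, Nat.card_eq_finsetCard,
    Nat.card_eq_finsetCard, hS₁, hS₂, Finset.card_product, Finset.card_range]

theorem code_sep_eq_span (hS₁ : S₁.card = s) (hS₂ : S₂.card = s) {J : Set grLex.syn}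
    (hJ : IsLowerSet J) :
    code S₁ S₂ {d ∈ Delta s | grLex.toSyn d ∈ J} = Submodule.span F
      ((fun d => evalPoints gridPoint (monomial d (1 : F))) '' (grLex.toSyn ⁻¹' J)) := by
  have hcode (L : Set (Fin 2 →₀ ℕ)) : code S₁ S₂ L =
      Submodule.span F ((fun d => evalPoints gridPoint (monomial d (1 : F))) '' L) := by
    rw [code, Submodule.map_span, ← Set.image_comp]
    rfl
  rw [hcode]
  refine le_antisymm (Submodule.span_mono (Set.image_mono fun d hd => hd.2)) ?_
  rw [← span_image_standardIndices_inter grLex.toSyn _ hJ]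
  refine Submodule.span_mono (Set.image_mono fun d hd => ⟨?_, hd.2⟩)
  have hd' := apply_mem_footprint.mpr hd.1
  rw [footprint_gridPoint hS₁ hS₂] at hd'
  simpa [Delta, Fin.forall_fin_two] using hd'

theorem mem_Iic_sdiff_Iio_iff {d : Fin 2 →₀ ℕ} :
    grLex.toSyn d ∈
        Set.Iic (grLex.toSyn (expo i₁ i₂)) \ Set.Iio (grLex.toSyn (expo i₂ i₁)) ↔
      (d 0, d 1) ∈ antidiagonalSegment i₁ i₂ := by
  simp only [Set.mem_sdiff, Set.mem_Iic, Set.mem_Iio, ← not_lt (a := grLex.toSyn (expo i₁ i₂)),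
    grLex_lt_iff, GrLexLT, expo_apply_zero, expo_apply_one, mem_antidiagonalSegment]
  lia

theorem ncard_standardMonomials_inter_Iic_sdiff_Iio :
    (standardMonomials grLex (evalPoints x) ∩ grLex.toSyn ⁻¹'
      (Set.Iic (grLex.toSyn (expo i₁ i₂)) \ Set.Iio (grLex.toSyn (expo i₂ i₁)))).ncard =
      (footprint x ∩ antidiagonalSegment i₁ i₂).card := by
  rw [← Set.ncard_coe_finset]
  refine Set.ncard_congr (fun d _ => (d 0, d 1)) (fun d hd => ?_) (fun d e _ _ h => ?_)
    (fun p hp => ⟨expo p.1 p.2, ?_, Prod.ext (expo_apply_zero _ _) (expo_apply_one _ _)⟩)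
  · exact Finset.mem_coe.mpr (Finset.mem_inter.mpr
      ⟨apply_mem_footprint.mpr hd.1, mem_Iic_sdiff_Iio_iff.mp hd.2⟩)
  · rw [← expo_apply_apply d, ← expo_apply_apply e, (Prod.mk.inj h).1, (Prod.mk.inj h).2]
  · obtain ⟨hfoot, hseg⟩ := Finset.mem_inter.mp hp
    refine ⟨mem_footprint.mp hfoot, mem_Iic_sdiff_Iio_iff.mpr ?_⟩
    rwa [expo_apply_zero, expo_apply_one]

end Footprint

section Codes

open MvPolynomial

variable {F : Type*} [Field F] {S₁ S₂ : Finset F} {s i₁ i₂ : ℕ}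

/-- The points of a set of participants, as a family of points of the plane. -/
def sharePoint (A : Finset (S₁ × S₂)) (p : A) : Fin 2 → F := gridPoint p.1

theorem card_footprint_sharePoint (A : Finset (S₁ × S₂)) :
    (footprint (sharePoint A)).card = A.card := by
  have hinj : (sharePoint A).Injective := gridPoint_injective.comp Subtype.val_injective
  rw [card_footprint hinj, Nat.card_eq_finsetCard]

theorem code_grLexLE (hS₁ : S₁.card = s) (hS₂ : S₂.card = s) (e : Fin 2 →₀ ℕ) :
    code S₁ S₂ {N ∈ Delta s | GrLexLE N e} = Submodule.span F
      ((fun d => evalPoints gridPoint (monomial d (1 : F))) ''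
        (grLex.toSyn ⁻¹' Set.Iic (grLex.toSyn e))) := by
  simp only [← code_sep_eq_span hS₁ hS₂ (isLowerSet_Iic _), Set.mem_Iic, grLex_le_iff]

theorem code_grLexLT (hS₁ : S₁.card = s) (hS₂ : S₂.card = s) (e : Fin 2 →₀ ℕ) :
    code S₁ S₂ {N ∈ Delta s | GrLexLT N e} = Submodule.span F
      ((fun d => evalPoints gridPoint (monomial d (1 : F))) ''
        (grLex.toSyn ⁻¹' Set.Iio (grLex.toSyn e))) := by
  simp only [← code_sep_eq_span hS₁ hS₂ (isLowerSet_Iio _), Set.mem_Iio, grLex_lt_iff]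

theorem Iio_expo_subset_Iic_expo (hi : i₁ ≤ i₂) :
    Set.Iio (grLex.toSyn (expo i₂ i₁)) ⊆ Set.Iic (grLex.toSyn (expo i₁ i₂)) := by
  refine (Set.Iio_subset_Iio (not_lt.mp ?_)).trans Set.Iio_subset_Iic_self
  rw [grLex_lt_iff, GrLexLT, expo_apply_zero, expo_apply_one, expo_apply_zero, expo_apply_one]
  lia

theorem code_grLexLT_le_code_grLexLE (hi : i₁ ≤ i₂) :
    code S₁ S₂ {N ∈ Delta s | GrLexLT N (expo i₂ i₁)} ≤
      code S₁ S₂ {N ∈ Delta s | GrLexLE N (expo i₁ i₂)} := by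
  refine Submodule.map_mono (Submodule.span_mono (Set.image_mono ?_))
  rintro d ⟨hd, hlt⟩
  exact ⟨hd, grLex_le_iff.mp (Iio_expo_subset_Iic_expo hi (grLex_lt_iff.mpr hlt))⟩

theorem finrank_code_grLexLE_eq_add (hS₁ : S₁.card = s) (hS₂ : S₂.card = s) (hi : i₁ ≤ i₂)
    (his : i₂ < s) :
    Module.finrank F (code S₁ S₂ {N ∈ Delta s | GrLexLE N (expo i₁ i₂)}) =
      Module.finrank F (code S₁ S₂ {N ∈ Delta s | GrLexLT N (expo i₂ i₁)}) + (i₂ - i₁ + 1) := by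
  have hseg : antidiagonalSegment i₁ i₂ ⊆ Finset.range s ×ˢ Finset.range s := fun p hp => by
    have := mem_antidiagonalSegment.mp hp
    simp only [Finset.mem_product, Finset.mem_range]
    lia
  have hcard := ncard_standardMonomials_inter_Iic_sdiff_Iio (i₁ := i₁) (i₂ := i₂)
    (x := (gridPoint : S₁ × S₂ → Fin 2 → F))
  rw [footprint_gridPoint hS₁ hS₂, Finset.inter_eq_right.mpr hseg, card_antidiagonalSegment,
    Nat.sub_add_comm hi] at hcard
  rw [code_grLexLE hS₁ hS₂, code_grLexLT hS₁ hS₂, ← hcard]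
  exact finrank_span_image_eq_add grLex.toSyn.injective _ (isLowerSet_Iic _) (isLowerSet_Iio _)
    (Iio_expo_subset_Iic_expo hi)

variable {k₂ ℓ : ℕ} {R : LinearRampScheme F (S₁ × S₂) k₂ ℓ}

theorem information_eq_card_footprint_inter (hS₁ : S₁.card = s) (hS₂ : S₂.card = s) (hi : i₁ ≤ i₂)
    (hR₁ : R.code₁ = code S₁ S₂ {N ∈ Delta s | GrLexLE N (expo i₁ i₂)})
    (hR₂ : R.code₂ = code S₁ S₂ {N ∈ Delta s | GrLexLT N (expo i₂ i₁)})
    (A : Finset (S₁ × S₂)) :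
    R.information A = (footprint (sharePoint A) ∩ antidiagonalSegment i₁ i₂).card := by
  rw [code_grLexLE hS₁ hS₂] at hR₁
  rw [code_grLexLT hS₁ hS₂] at hR₂
  rw [← ncard_standardMonomials_inter_Iic_sdiff_Iio]
  exact LinearRampScheme.information_eq_ncard grLex.toSyn.injective (isLowerSet_Iic _)
    (isLowerSet_Iio _) (Iio_expo_subset_Iic_expo hi) hR₁ hR₂ A

theorem secretLength_eq (hS₁ : S₁.card = s) (hS₂ : S₂.card = s) (hi : i₁ ≤ i₂) (his : i₂ < s)
    (hR₁ : R.code₁ = code S₁ S₂ {N ∈ Delta s | GrLexLE N (expo i₁ i₂)})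
    (hR₂ : R.code₂ = code S₁ S₂ {N ∈ Delta s | GrLexLT N (expo i₂ i₁)}) : ℓ = i₂ - i₁ + 1 := by
  have h := finrank_code_grLexLE_eq_add hS₁ hS₂ hi his
  rw [← hR₁, ← hR₂, R.finrank_code₁, R.finrank_code₂] at h
  exact Nat.add_left_cancel h

end Codes

section Thresholds

variable {F : Type*} [Field F] {S₁ S₂ : Finset F} {s i₁ i₂ k₂ ℓ k : ℕ}
  {R : LinearRampScheme F (S₁ × S₂) k₂ ℓ} {A : Finset (S₁ × S₂)}

theorem le_card_of_lt_information
    (hR : ∀ A, R.information A = (footprint (sharePoint A) ∩ antidiagonalSegment i₁ i₂).card)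
    (hk : k < R.information A) : (i₂ + 1) * (i₁ + 1 + k) ≤ A.card + (k + 1).choose 2 := by
  rw [← card_footprint_sharePoint A]
  exact le_card_of_isLowerSet isLowerSet_footprint (hR A ▸ hk)

theorem mul_le_of_isPrivacyNumber
    (hR : ∀ A, R.information A = (footprint (sharePoint A) ∩ antidiagonalSegment i₁ i₂).card)
    {m t : ℕ} (hm : 1 ≤ m) (hmℓ : m ≤ ℓ) (ht : R.IsPrivacyNumber m t) :
    (i₂ + 1) * (i₁ + m) ≤ t + 1 + m.choose 2 := by
  obtain ⟨k, rfl⟩ := Nat.exists_eq_add_of_le' hm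
  have h := ht.le_add_one (n := (i₂ + 1) * (i₁ + (k + 1)) - (k + 1).choose 2) hmℓ fun A hA => by
    have := le_card_of_lt_information hR hA
    lia
  lia

theorem card_add_le_of_information_lt (hS₁ : S₁.card = s) (hS₂ : S₂.card = s) (hi : i₁ ≤ i₂)
    (his : i₂ < s)
    (hR : ∀ A, R.information A = (footprint (sharePoint A) ∩ antidiagonalSegment i₁ i₂).card)
    (hk : R.information A + k < i₂ - i₁ + 1) :
    A.card + (s - i₁) * (s - i₂ + k) ≤ s ^ 2 + (k + 1).choose 2 := by
  have hsum := Finset.card_sdiff_add_card_inter (antidiagonalSegment i₁ i₂)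
    (footprint (sharePoint A))
  rw [Finset.inter_comm, ← hR, card_antidiagonalSegment] at hsum
  rw [← card_footprint_sharePoint A]
  exact card_add_le_of_isLowerSet isLowerSet_footprint
    (footprint_comp_gridPoint_subset hS₁ hS₂ Subtype.val) hi his (by lia)

theorem notMem_footprint_of_disjoint_box (β₁ : Fin s ≃ S₁) (β₂ : Fin s ≃ S₂) (his : i₂ < s)
    {w : ℕ} (hw : w ∈ Finset.Icc 1 (i₂ - i₁ + 1)) (hi : i₁ ≤ i₂)
    (hA : Disjoint A (box β₁ β₂ i₁ i₂ w)) :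
    (i₂ + 1 - w, i₁ + w - 1) ∉ footprint (sharePoint A) := by
  obtain ⟨hw₁, hwℓ⟩ := Finset.mem_Icc.mp hw
  let T₁ : Finset F := (Finset.Iio ⟨i₂ + 1 - w, by lia⟩).map
    (β₁.toEmbedding.trans (Function.Embedding.subtype _))
  let T₂ : Finset F := (Finset.Iio ⟨i₁ + w - 1, by lia⟩).map
    (β₂.toEmbedding.trans (Function.Embedding.subtype _))
  have hcover (p : A) : sharePoint A p 0 ∈ T₁ ∨ sharePoint A p 1 ∈ T₂ := by
    have hp := Finset.disjoint_left.mp hA p.2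
    simp only [box, Finset.mem_filter_univ, not_and_or, not_le] at hp
    refine hp.imp (fun h => Finset.mem_map.mpr ⟨β₁.symm p.1.1, ?_, ?_⟩)
      fun h => Finset.mem_map.mpr ⟨β₂.symm p.1.2, ?_, ?_⟩
    · exact Finset.mem_Iio.mpr (Fin.lt_def.mpr (by lia))
    · simp [sharePoint, gridPoint]
    · exact Finset.mem_Iio.mpr (Fin.lt_def.mpr (by lia))
    · simp [sharePoint, gridPoint]
  simpa [T₁, T₂] using card_card_notMem_footprint hcover

section Complements

variable [DecidableEq F]

theorem nonQualifying_compl_biUnion_box (β₁ : Fin s ≃ S₁) (β₂ : Fin s ≃ S₂) (hi : i₁ ≤ i₂)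
    (his : i₂ < s)
    (hR : ∀ A, R.information A = (footprint (sharePoint A) ∩ antidiagonalSegment i₁ i₂).card)
    {J : Finset ℕ} (hJ : J ⊆ Finset.Icc 1 (i₂ - i₁ + 1)) :
    R.NonQualifying (i₂ - i₁ + 1 + 1 - J.card)
      (Finset.univ \ J.biUnion (box β₁ β₂ i₁ i₂)) := by
  set A := Finset.univ \ J.biUnion (box β₁ β₂ i₁ i₂)
  have hJ' (w : ℕ) (hw : w ∈ J) : 1 ≤ w ∧ w ≤ i₂ - i₁ + 1 := Finset.mem_Icc.mp (hJ hw)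
  have hmissing : J.card ≤ (antidiagonalSegment i₁ i₂ \ footprint (sharePoint A)).card := by
    refine Finset.card_le_card_of_injOn (fun w => (i₂ + 1 - w, i₁ + w - 1)) (fun w hw => ?_)
      fun v hv w hw hvw => ?_
    · have hdisj : Disjoint A (box β₁ β₂ i₁ i₂ w) :=
        Finset.sdiff_disjoint.mono_right (Finset.subset_biUnion_of_mem _ hw)
      refine Finset.mem_coe.mpr (Finset.mem_sdiff.mpr ⟨mem_antidiagonalSegment.mpr ?_,
        notMem_footprint_of_disjoint_box β₁ β₂ his (hJ hw) hi hdisj⟩)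
      have := hJ' w hw
      lia
    · have := hJ' v hv
      have := hJ' w hw
      simp only [Prod.mk.injEq] at hvw
      lia
  have hsum := Finset.card_sdiff_add_card_inter (antidiagonalSegment i₁ i₂)
    (footprint (sharePoint A))
  rw [Finset.inter_comm, ← hR, card_antidiagonalSegment] at hsum
  rw [LinearRampScheme.NonQualifying]
  lia

theorem maximumNonQualifying_compl_biUnion_box (hS₁ : S₁.card = s) (hS₂ : S₂.card = s)
    (β₁ : Fin s ≃ S₁) (β₂ : Fin s ≃ S₂) (hi : i₁ ≤ i₂)
    (his : i₂ < s)
    (hR : ∀ A, R.information A = (footprint (sharePoint A) ∩ antidiagonalSegment i₁ i₂).card)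
    {J : Finset ℕ} (hJ : J ⊆ Finset.Icc 1 (i₂ - i₁ + 1)) (hJ' : J = Finset.Icc 1 J.card ∨
      J = Finset.Icc (i₂ - i₁ + 1 + 1 - J.card) (i₂ - i₁ + 1)) :
    R.MaximumNonQualifying (i₂ - i₁ + 1 + 1 - J.card)
      (Finset.univ \ J.biUnion (box β₁ β₂ i₁ i₂)) := by
  refine ⟨nonQualifying_compl_biUnion_box β₁ β₂ hi his hR hJ, fun B hB => ?_⟩
  rcases J.eq_empty_or_nonempty with rfl | hne
  · simpa using B.card_le_univ
  obtain ⟨k, hk⟩ := Nat.exists_eq_succ_of_ne_zero hne.card_ne_zero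
  have hkℓ := Finset.card_le_card hJ
  rw [Nat.card_Icc] at hkℓ
  rw [hk, Nat.add_sub_add_right] at hJ' hB
  have hcard := card_compl_biUnion_box_add β₁ β₂ his (by lia) hJ'
  have hle := card_add_le_of_information_lt hS₁ hS₂ hi his hR (Nat.add_lt_of_lt_sub hB)
  lia

end Complements

theorem exists_isReconstructionNumber_add_mul_eq (hS₁ : S₁.card = s) (hS₂ : S₂.card = s)
    (hi : i₁ ≤ i₂) (his : i₂ < s) (hℓ : ℓ = i₂ - i₁ + 1)
    (hR : ∀ A, R.information A = (footprint (sharePoint A) ∩ antidiagonalSegment i₁ i₂).card)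
    (hk : k < ℓ) :
    ∃ r, R.IsReconstructionNumber (ℓ - k) r ∧
      r + (s - i₁) * (s - i₂ + k) = s ^ 2 + (k + 1).choose 2 + 1 := by
  classical
  let β₁ : Fin s ≃ S₁ := (S₁.equivFinOfCardEq hS₁).symm
  let β₂ : Fin s ≃ S₂ := (S₂.equivFinOfCardEq hS₂).symm
  have hJ : Finset.Icc 1 (k + 1) ⊆ Finset.Icc 1 (i₂ - i₁ + 1) :=
    Finset.Icc_subset_Icc_right (by lia)
  have hmax := maximumNonQualifying_compl_biUnion_box hS₁ hS₂ β₁ β₂ hi his hR hJ (.inl (by simp))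
  have hkseg : i₁ + k ≤ i₂ := by lia
  have hcard := card_compl_biUnion_box_add β₁ β₂ his hkseg (.inl rfl)
  rw [← hℓ, Nat.card_Icc, Nat.add_sub_cancel, Nat.add_sub_add_right] at hmax
  exact ⟨_, R.isReconstructionNumber_card_add_one (Nat.sub_le ℓ k) hmax, by lia⟩

end Thresholds

end MonomialCartesian

section Formulas

theorem sum_Icc_two_sub (c : ℚ) (v : ℕ) :
    ∑ t ∈ Finset.Icc 2 (v + 1), (c - ((t : ℚ) - 1)) = v * c - (v + 1) * v / 2 := by
  induction v with
  | zero => simp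
  | succ v ih =>
    rw [Finset.sum_Icc_succ_top (by lia), ih]
    push_cast
    ring

theorem cast_ge_of_add_choose_two_ge {m t i₁ i₂ : ℕ}
    (h : (i₂ + 1) * (i₁ + m) ≤ t + 1 + m.choose 2) :
    (t : ℚ) ≥ (i₁ + m) * (i₂ + 1) - m * (m - 1) / 2 - 1 := by
  have h' : ((i₂ : ℚ) + 1) * (i₁ + m) ≤ t + 1 + m.choose 2 := mod_cast h
  rw [Nat.cast_choose_two] at h'
  linarith

theorem cast_eq_of_add_mul_eq {s i₁ i₂ m ℓ r : ℕ} (h₁ : i₁ ≤ s) (h₂ : i₂ ≤ s) (hm : m ≤ ℓ)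
    (h : r + (s - i₁) * (s - i₂ + (ℓ - m)) = s ^ 2 + (ℓ - m + 1).choose 2 + 1) :
    (r : ℚ) = s ^ 2 - (s - i₁) * (s - i₂ + ℓ - m) + (ℓ - m + 1) * (ℓ - m) / 2 + 1 := by
  have h' := congrArg (Nat.cast : ℕ → ℚ) h
  push_cast [Nat.cast_choose_two, Nat.cast_sub h₁, Nat.cast_sub h₂, Nat.cast_sub hm] at h'
  linarith

end Formulas

open MonomialCartesian in
theorem mainTheorem1_general {F : Type*} [Field F] [DecidableEq F]
    (S₁ S₂ : Finset F) (s i₁ i₂ : ℕ) (hS₁ : S₁.card = s) (hS₂ : S₂.card = s)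
    (hi : i₁ ≤ i₂) (his : i₂ < s)
    (β₁ : Fin s ≃ S₁) (β₂ : Fin s ≃ S₂)
    (L₁ L₂ : Set (Fin 2 →₀ ℕ))
    (hL₁ : L₁ = {N ∈ Delta s | GrLexLE N (expo i₁ i₂)})
    (hL₂ : L₂ = {N ∈ Delta s | GrLexLT N (expo i₂ i₁)}) :
    code S₁ S₂ L₂ ≤ code S₁ S₂ L₁ ∧
    Module.finrank F (code S₁ S₂ L₁) = Module.finrank F (code S₁ S₂ L₂) + (i₂ - i₁ + 1) ∧
    ∀ (k₂ ℓ : ℕ) (R : LinearRampScheme F (S₁ × S₂) k₂ ℓ),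
      R.code₁ = code S₁ S₂ L₁ → R.code₂ = code S₁ S₂ L₂ →
      ℓ = i₂ - i₁ + 1 ∧
      (∀ m : ℕ, 1 ≤ m → m ≤ ℓ →
        (∃ t : ℕ, R.IsPrivacyNumber m t ∧
          (t : ℚ) ≥ (i₁ + m) * (i₂ + 1) - m * (m - 1) / 2 - 1) ∧
        (∃ r : ℕ, R.IsReconstructionNumber m r ∧
          (r : ℚ) = s ^ 2 - ((s - i₁) * (s - i₂) +
            ∑ t ∈ Finset.Icc 2 (ℓ - m + 1), (((s : ℚ) - i₁) - (t - 1))) + 1 ∧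
          (r : ℚ) = s ^ 2 - (s - i₁) * (s - i₂ + ℓ - m) + (ℓ - m + 1) * (ℓ - m) / 2 + 1)) ∧
      (∀ J : Finset ℕ, J ⊆ Finset.Icc 1 ℓ → ∀ u : ℕ, u = ℓ + 1 - J.card →
        R.NonQualifying u (Finset.univ \ J.biUnion (box β₁ β₂ i₁ i₂)) ∧
        (J = Finset.Icc 1 J.card ∨ J = Finset.Icc u ℓ →
          R.MaximumNonQualifying u (Finset.univ \ J.biUnion (box β₁ β₂ i₁ i₂)))) := by
  subst hL₁ hL₂
  refine ⟨code_grLexLT_le_code_grLexLE hi, finrank_code_grLexLE_eq_add hS₁ hS₂ hi his,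
    fun k₂ ℓ R hR₁ hR₂ => ?_⟩
  have hR := information_eq_card_footprint_inter hS₁ hS₂ hi hR₁ hR₂
  obtain rfl := secretLength_eq hS₁ hS₂ hi his hR₁ hR₂
  refine ⟨rfl, fun m hm hmℓ => ⟨?_, ?_⟩, ?_⟩
  · obtain ⟨t, ht⟩ := R.exists_isPrivacyNumber hm
    exact ⟨t, ht, cast_ge_of_add_choose_two_ge (mul_le_of_isPrivacyNumber hR hm hmℓ ht)⟩
  · obtain ⟨r, hr, hrcard⟩ :=
      exists_isReconstructionNumber_add_mul_eq hS₁ hS₂ hi his rfl hR (Nat.sub_lt_self hm hmℓ)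
    rw [Nat.sub_sub_self hmℓ] at hr
    have hformula := cast_eq_of_add_mul_eq (by lia) his.le hmℓ hrcard
    refine ⟨r, hr, ?_, hformula⟩
    rw [hformula, sum_Icc_two_sub, Nat.cast_sub hmℓ]
    ring
  · rintro J hJ _ rfl
    exact ⟨nonQualifying_compl_biUnion_box β₁ β₂ hi his hR hJ,
      maximumNonQualifying_compl_biUnion_box hS₁ hS₂ β₁ β₂ hi his hR hJ⟩

theorem mainTheorem1 {F : Type*} [Field F] [Finite F] [DecidableEq F]
    (S₁ S₂ : Finset F) (s i₁ i₂ : ℕ) (hS₁ : S₁.card = s) (hS₂ : S₂.card = s)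
    (hi : i₁ < i₂) (his : i₂ ≤ s - 1)
    (β₁ : Fin s ≃ S₁) (β₂ : Fin s ≃ S₂)
    (L₁ L₂ : Set (Fin 2 →₀ ℕ))
    (hL₁ : L₁ = {N ∈ MonomialCartesian.Delta s |
      MonomialCartesian.GrLexLE N (MonomialCartesian.expo i₁ i₂)})
    (hL₂ : L₂ = {N ∈ MonomialCartesian.Delta s |
      MonomialCartesian.GrLexLT N (MonomialCartesian.expo i₂ i₁)}) :
    MonomialCartesian.code S₁ S₂ L₂ ≤ MonomialCartesian.code S₁ S₂ L₁ ∧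
    Module.finrank F (MonomialCartesian.code S₁ S₂ L₁) =
      Module.finrank F (MonomialCartesian.code S₁ S₂ L₂) + (i₂ - i₁ + 1) ∧
    ∀ (k₂ ℓ : ℕ) (R : LinearRampScheme F (S₁ × S₂) k₂ ℓ),
      R.code₁ = MonomialCartesian.code S₁ S₂ L₁ → R.code₂ = MonomialCartesian.code S₁ S₂ L₂ →
      ℓ = i₂ - i₁ + 1 ∧
      (∀ m : ℕ, 1 ≤ m → m ≤ ℓ →
        (∃ t : ℕ, R.IsPrivacyNumber m t ∧
          (t : ℚ) ≥ (i₁ + m) * (i₂ + 1) - m * (m - 1) / 2 - 1) ∧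
        (∃ r : ℕ, R.IsReconstructionNumber m r ∧
          (r : ℚ) = s ^ 2 - ((s - i₁) * (s - i₂) +
            ∑ t ∈ Finset.Icc 2 (ℓ - m + 1), (((s : ℚ) - i₁) - (t - 1))) + 1 ∧
          (r : ℚ) = s ^ 2 - (s - i₁) * (s - i₂ + ℓ - m) + (ℓ - m + 1) * (ℓ - m) / 2 + 1)) ∧
      (∀ J : Finset ℕ, J ⊆ Finset.Icc 1 ℓ → ∀ u : ℕ, u = ℓ + 1 - J.card →
        R.NonQualifying u (Finset.univ \ J.biUnion (MonomialCartesian.box β₁ β₂ i₁ i₂)) ∧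
        (J = Finset.Icc 1 J.card ∨ J = Finset.Icc u ℓ →
          R.MaximumNonQualifying u
            (Finset.univ \ J.biUnion (MonomialCartesian.box β₁ β₂ i₁ i₂)))) :=
  mainTheorem1_general S₁ S₂ s i₁ i₂ hS₁ hS₂ hi.le (by lia) β₁ β₂ L₁ L₂ hL₁ hL₂
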